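/- Let $m$ be a natural number and let $X=\mathbb{R}^m$ with the Euclidean inner product $\langle\cdot,\cdot\rangle$ and norm; the dual of $X$ is identified with $X$ through the inner product. A function $g:X\to\mathbb{R}$ is Gâteaux differentiable at $x\in X$ if there is a vector $\nabla g(x)\in X$ with $\lim_{t\to 0}\frac{g(x+ty)-g(x)}{t}=\langle\nabla g(x),y\rangle$ for all $y\in X$. A function $f:X\to\mathbb{R}$ is called fully Legendre if it is lower semicontinuous, convex and Gâteaux differentiable on all of $X$, and its convex conjugate $f^*(y)=\sup\{\langle y,x\rangle-f(x): x\in X\}$ is finite and Gâteaux differentiable on all of $X$. A set-valued operator $A:X\to 2^X$ is monotone if $\langle u_1-u_2,x_1-x_2\rangle\ge 0$ whenever $u_1\in A(x_1)$ and $u_2\in A(x_2)$; it is maximally monotone if it is monotone and every monotone operator $B:X\to 2^X$ with $A(x)\subseteq B(x)$ for all $x\in X$ equals $A$. For $\lambda>0$, the operator $\nabla f+\lambda A$ is $x\mapsto\{\nabla f(x)+\lambda u: u\in A(x)\}$, and the inverse of an operator $B:X\to 2^X$ is $B^{-1}(w)=\{x\in X: w\in B(x)\}$. **Theorem 7.1.**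 Let $f:X\to\mathbb{R}$ be fully Legendre and let $A:X\to 2^X$ be maximally monotone. Then for each $x_0\in X$, each sequence $(\lambda_n)_{n=0}^\infty$ of positive real numbers and each sequence $(\eta_n)_{n=1}^\infty$ of vectors in $X$, there exists a unique sequence $(x_n)_{n=1}^\infty$ of elements of $X$ such that $$\eta_{n+1}+\nabla f(x_n)\in\lambda_n A(x_{n+1})+\nabla f(x_{n+1})\qquad\text{for all } n\ge 0.$$ Moreover, $x_{n+1}=(\nabla f+\lambda_n A)^{-1}(\eta_{n+1}+\nabla f(x_n))$ for all $n\ge 0$, in the sense that the set $(\nabla f+\lambda_n A)^{-1}(\eta_{n+1}+\nabla f(x_n))$ consists of exactly the one point $x_{n+1}$. -/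

import Mathlib

open scoped Pointwise

namespace BregmanProx

section Functions

variable {E : Type*} [NormedAddCommGroup E] [InnerProductSpace ℝ E]

/-- `g` is the Gateaux gradient of `f` at `x`: for every direction `y`, the limit of
`(f (x + t y) - f x) / t` as `t → 0`, `t ≠ 0`, exists and equals `⟪g, y⟫`.  (The dual of the
Euclidean space `E` is identified with `E` through the inner product.) -/
def HasGateauxGradientAt (f : E → ℝ) (g x : E) : Prop :=
  ∀ y : E, Filter.Tendsto (fun t : ℝ => (f (x + t • y) - f x) / t)
    (nhdsWithin 0 {0}ᶜ) (nhds (inner ℝ g y))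

/-- `f` is Gateaux differentiable at `x`. -/
def GateauxDifferentiableAt (f : E → ℝ) (x : E) : Prop :=
  ∃ g : E, HasGateauxGradientAt f g x

open Classical in
/-- The Gateaux gradient `∇f(x)` (with the value `0` where `f` is not Gateaux differentiable). -/
noncomputable def gateauxGradient (f : E → ℝ) (x : E) : E :=
  if h : GateauxDifferentiableAt f x then h.choose else 0

theorem GateauxDifferentiableAt.hasGateauxGradientAt {f : E → ℝ} {x : E}
    (h : GateauxDifferentiableAt f x) : HasGateauxGradientAt f (gateauxGradient f x) x := by
  unfold gateauxGradient
  rw [dif_pos h]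
  exact h.choose_spec

theorem HasGateauxGradientAt.gateauxGradient_eq {f : E → ℝ} {g x : E}
    (h : HasGateauxGradientAt f g x) : gateauxGradient f x = g := by
  have h' := GateauxDifferentiableAt.hasGateauxGradientAt ⟨g, h⟩
  exact ext_inner_right ℝ fun y => tendsto_nhds_unique (h' y) (h y)

/-- The convex (Fenchel) conjugate `f*(y) = sup {⟪y, x⟫ - f x : x ∈ E}`, with values in the
extended reals. -/
noncomputable def conjugate (f : E → ℝ) (y : E) : EReal :=
  ⨆ x : E, ((inner ℝ y x - f x : ℝ) : EReal)

/-- A real-valued function `f` is fully Legendre if it is lower semicontinuous, convex and Gateaux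
differentiable on the whole space, and its conjugate `f*` is finite and Gateaux differentiable on
the whole (dual) space. -/
structure FullyLegendre (f : E → ℝ) : Prop where
  lowerSemicontinuous : LowerSemicontinuous f
  convexOn : ConvexOn ℝ Set.univ f
  gateauxDifferentiableAt : ∀ x : E, GateauxDifferentiableAt f x
  conjugate_gateauxDifferentiable : ∃ fstar : E → ℝ,
    (∀ y : E, conjugate f y = (fstar y : EReal)) ∧ ∀ y : E, GateauxDifferentiableAt fstar y

end Functions

section Operators

variable {E : Type*} [NormedAddCommGroup E] [InnerProductSpace ℝ E]

/-- Monotonicity of a set-valued operator. -/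
def IsMonotoneOperator (A : E → Set E) : Prop :=
  ∀ x₁ x₂ u₁ u₂ : E, u₁ ∈ A x₁ → u₂ ∈ A x₂ → 0 ≤ inner ℝ (u₁ - u₂) (x₁ - x₂)

/-- Maximal monotonicity: `A` is monotone, and every monotone operator whose graph contains the
graph of `A` is equal to `A`. -/
def IsMaximallyMonotone (A : E → Set E) : Prop :=
  IsMonotoneOperator A ∧
    ∀ B : E → Set E, IsMonotoneOperator B → (∀ x, A x ⊆ B x) → B = A

/-- The inverse of a set-valued operator: `x ∈ B⁻¹ w` if and only if `w ∈ B x`. -/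
def operatorInverse (B : E → Set E) (w : E) : Set E :=
  {x : E | w ∈ B x}

/-- The set-valued operator `∇f + c A`, that is, `x ↦ {∇f(x)} + {c u : u ∈ A x}`
(empty where `A x` is empty). -/
noncomputable def gradientAddSMul (f : E → ℝ) (c : ℝ) (A : E → Set E) (x : E) : Set E :=
  {gateauxGradient f x} + c • A x

end Operators

end BregmanProx

/-!
The heart of the matter is that `∇f + B` is a bijection onto the space when `f` is fully Legendre
and `B` is maximally monotone; the theorem is then a recursion with `B = lam n • A`.

Injectivity: if `⟪∇f x - ∇f y, x - y⟫ ≤ 0`, then `x` and `y` both maximise `⟪∇f y, ·⟫ - f`, so both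
are subgradients of `f*` at `∇f y`, and `x = y` since `f*` is differentiable
(`FullyLegendre.eq_of_inner_gradient_sub_nonpos`).

Surjectivity: fix the target `w`. In `E × E × ℝ`, the convex hull of the points `(y, v, ⟪y, v⟫)` with
`v ∈ B y` lies above the graph of `(y, v) ↦ ⟪y, v⟫` (`inner_le_of_mem_convexHull_graph`), while the
open convex set `t < ⟪w, y⟫ - f y - f* (w - v)` lies below it by the Fenchel-Young inequality. A
hyperplane separating the two cannot be vertical, and its slope encodes a point `(x, u)` such that
`f x + f* (w - u) - ⟪x, w - u⟫ ≤ ⟪u - v, x - y⟫` for all `v ∈ B y`. The left side is nonnegative, so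
`u ∈ B x` by maximality; taking `(y, v) = (x, u)` gives equality in Fenchel-Young, that is,
`w - u = ∇f x` (`FullyLegendre.exists_sub_gradient_mem`). This is the Fitzpatrick-function proof of
Minty's theorem, and it needs no coercivity or fixed-point argument.
-/

namespace BregmanProx

variable {E : Type*} [NormedAddCommGroup E] [InnerProductSpace ℝ E]

/-! ### Gateaux gradients of convex functions -/

theorem HasGateauxGradientAt.add_inner_le {f : E → ℝ} {g x : E} (hf : ConvexOn ℝ Set.univ f)
    (h : HasGateauxGradientAt f g x) (y : E) : f x + inner ℝ g (y - x) ≤ f y := by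
  have h1 := (h (y - x)).mono_left
    (nhdsWithin_mono (0 : ℝ) (show Set.Ioi (0 : ℝ) ⊆ {0}ᶜ from fun t ht => ne_of_gt ht))
  have h2 : inner ℝ g (y - x) ≤ f y - f x := by
    refine le_of_tendsto h1 ?_
    filter_upwards [Ioo_mem_nhdsGT (zero_lt_one' ℝ)] with t ht
    rw [div_le_iff₀ ht.1]
    have h3 := hf.2 (Set.mem_univ x) (Set.mem_univ y) (sub_nonneg.2 ht.2.le) ht.1.le (by ring)
    have h4 : (1 - t) • x + t • y = x + t • (y - x) := by module
    rw [h4] at h3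
    simp only [smul_eq_mul] at h3
    linarith
  linarith

/-- The Gateaux gradient is the only possible subgradient. -/
theorem HasGateauxGradientAt.eq_of_subgradient {f : E → ℝ} {g g' x : E}
    (h : HasGateauxGradientAt f g x) (hg' : ∀ y, f x + inner ℝ g' (y - x) ≤ f y) : g' = g := by
  have key : ∀ y, inner ℝ g' y ≤ inner ℝ g y := fun y => by
    have h1 := (h y).mono_left
      (nhdsWithin_mono (0 : ℝ) (show Set.Ioi (0 : ℝ) ⊆ {0}ᶜ from fun t ht => ne_of_gt ht))
    refine ge_of_tendsto h1 ?_
    filter_upwards [self_mem_nhdsWithin] with t ht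
    rw [le_div_iff₀ ht]
    have h2 := hg' (x + t • y)
    rw [add_sub_cancel_left, inner_smul_right] at h2
    linarith
  refine ext_inner_right ℝ fun y => le_antisymm (key y) ?_
  have := key (-y)
  simp only [inner_neg_right] at this
  linarith

/-! ### The conjugate of a fully Legendre function -/

theorem FullyLegendre.add_inner_gradient_le {f : E → ℝ} (hf : FullyLegendre f) (x y : E) :
    f x + inner ℝ (gateauxGradient f x) (y - x) ≤ f y :=
  (hf.gateauxDifferentiableAt x).hasGateauxGradientAt.add_inner_le hf.convexOn y

/-- The conjugate of a fully Legendre function as a real-valued function, described by its defining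
supremum. -/
theorem FullyLegendre.exists_isLUB_conjugate {f : E → ℝ} (hf : FullyLegendre f) :
    ∃ fs : E → ℝ, (∀ y, IsLUB (Set.range fun x => inner ℝ y x - f x) (fs y)) ∧
      ∀ y, GateauxDifferentiableAt fs y := by
  obtain ⟨fs, h1, h2⟩ := hf.conjugate_gateauxDifferentiable
  refine ⟨fs, fun y => ⟨?_, fun c hc => ?_⟩, h2⟩
  · rintro _ ⟨x, rfl⟩
    have h := le_iSup (fun x : E => ((inner ℝ y x - f x : ℝ) : EReal)) x
    rw [← conjugate, h1 y] at h
    exact EReal.coe_le_coe_iff.1 h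
  · rw [← EReal.coe_le_coe_iff, ← h1 y]
    exact iSup_le fun x => EReal.coe_le_coe_iff.2 (hc ⟨x, rfl⟩)

theorem convexOn_of_isLUB_conjugate {f fs : E → ℝ}
    (h : ∀ y, IsLUB (Set.range fun x => inner ℝ y x - f x) (fs y)) : ConvexOn ℝ Set.univ fs := by
  refine ⟨convex_univ, fun y _ z _ a b ha hb hab => (h _).2 ?_⟩
  rintro _ ⟨x, rfl⟩
  have h1 := mul_le_mul_of_nonneg_left ((h y).1 ⟨x, rfl⟩) ha
  have h2 := mul_le_mul_of_nonneg_left ((h z).1 ⟨x, rfl⟩) hb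
  simp only [inner_add_left, real_inner_smul_left, smul_eq_mul] at h1 h2 ⊢
  obtain rfl : b = 1 - a := by linarith
  linarith

/-- The gradient of a fully Legendre function is strictly monotone. -/
theorem FullyLegendre.eq_of_inner_gradient_sub_nonpos {f : E → ℝ} (hf : FullyLegendre f) {x y : E}
    (h : inner ℝ (gateauxGradient f x - gateauxGradient f y) (x - y) ≤ 0) : x = y := by
  obtain ⟨fs, hfs, hd⟩ := hf.exists_isLUB_conjugate
  set g := gateauxGradient f y with hg
  have hy : ∀ z, f y + inner ℝ g (z - y) ≤ f z := hf.add_inner_gradient_le y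
  have hx : inner ℝ g x - f x = inner ℝ g y - f y := by
    have h1 := hf.add_inner_gradient_le x y
    have h2 := hy x
    simp only [inner_sub_left, inner_sub_right] at h h1 h2
    linarith
  have hmax : fs g ≤ inner ℝ g y - f y := (hfs g).2 <| by
    rintro _ ⟨z, rfl⟩
    have := hy z
    simp only [inner_sub_right] at this ⊢
    linarith
  -- Any maximiser of `⟪g, ·⟫ - f` is a subgradient of `f*` at `g`.
  have key : ∀ z, fs g ≤ inner ℝ g z - f z → z = gateauxGradient fs g := fun z hz =>
    (hd g).hasGateauxGradientAt.eq_of_subgradient fun v => by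
      have h1 : inner ℝ v z - f z ≤ fs v := (hfs v).1 ⟨z, rfl⟩
      rw [inner_sub_right, real_inner_comm v z, real_inner_comm g z]
      linarith
  rw [key x (hx ▸ hmax), ← key y hmax]

/-! ### Monotone operators -/

theorem IsMaximallyMonotone.mem_of_forall {A : E → Set E} (hA : IsMaximallyMonotone A) {x u : E}
    (h : ∀ y v, v ∈ A y → 0 ≤ inner ℝ (u - v) (x - y)) : u ∈ A x := by
  have hB := hA.2 (fun z => A z ∪ {v | z = x ∧ v = u}) ?_ fun z => Set.subset_union_left
  · rw [← hB]
    exact Or.inr ⟨rfl, rfl⟩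
  · rintro x₁ x₂ u₁ u₂ (h1 | ⟨rfl, rfl⟩) (h2 | ⟨rfl, rfl⟩)
    · exact hA.1 _ _ _ _ h1 h2
    · have := h _ _ h1
      rwa [← neg_sub u₁, ← neg_sub x₁, inner_neg_neg] at this
    · exact h _ _ h2
    · simp

theorem IsMaximallyMonotone.exists_mem {A : E → Set E} (hA : IsMaximallyMonotone A) :
    ∃ x u, u ∈ A x := by
  by_contra! hne
  exact hne 0 0 (hA.mem_of_forall fun y v hv => (hne y v hv).elim)

theorem IsMonotoneOperator.smul {A : E → Set E} (hA : IsMonotoneOperator A) {c : ℝ} (hc : 0 ≤ c) :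
    IsMonotoneOperator (c • A) := by
  rintro x₁ x₂ _ _ ⟨u₁, h1, rfl⟩ ⟨u₂, h2, rfl⟩
  simp only [← smul_sub, real_inner_smul_left]
  exact mul_nonneg hc (hA _ _ _ _ h1 h2)

theorem IsMaximallyMonotone.smul {A : E → Set E} (hA : IsMaximallyMonotone A) {c : ℝ}
    (hc : 0 < c) : IsMaximallyMonotone (c • A) := by
  refine ⟨hA.1.smul hc.le, fun B hB hAB => ?_⟩
  rw [← hA.2 (c⁻¹ • B) (hB.smul (inv_nonneg.2 hc.le)) fun x => ?_, smul_inv_smul₀ hc.ne']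
  exact (Set.subset_smul_set_iff₀ (inv_ne_zero hc.ne')).2 (by simpa using hAB x)

/-- Convex combinations of the points `(y, v, ⟪y, v⟫)` over a monotone graph stay above the graph of
the inner product. -/
theorem inner_le_of_mem_convexHull_graph {A : E → Set E} (hA : IsMonotoneOperator A)
    {p : E × E × ℝ}
    (hp : p ∈ convexHull ℝ {p : E × E × ℝ | p.2.1 ∈ A p.1 ∧ p.2.2 = inner ℝ p.1 p.2.1}) :
    inner ℝ p.1 p.2.1 ≤ p.2.2 := by
  set S := {p : E × E × ℝ | p.2.1 ∈ A p.1 ∧ p.2.2 = inner ℝ p.1 p.2.1} with hS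
  -- The polarised inequality is affine in each of `p` and `q`, so it extends to the hull one
  -- variable at a time.
  have hconv : ∀ q : E × E × ℝ,
      Convex ℝ {p : E × E × ℝ | inner ℝ p.1 q.2.1 + inner ℝ q.1 p.2.1 ≤ p.2.2 + q.2.2} := by
    intro q p hp r hr a b ha hb hab
    have h1 := mul_le_mul_of_nonneg_left hp ha
    have h2 := mul_le_mul_of_nonneg_left hr hb
    simp only [Set.mem_ofPred_eq, Prod.fst_add, Prod.snd_add, Prod.smul_fst, Prod.smul_snd,
      inner_add_left, inner_add_right, real_inner_smul_left, real_inner_smul_right,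
      smul_eq_mul] at h1 h2 ⊢
    obtain rfl : b = 1 - a := by linarith
    linarith
  have h1 : ∀ q ∈ S, ∀ r ∈ convexHull ℝ S,
      inner ℝ r.1 q.2.1 + inner ℝ q.1 r.2.1 ≤ r.2.2 + q.2.2 := fun q hq r hr => by
    refine convexHull_min (fun r hr => ?_) (hconv q) hr
    have h := hA _ _ _ _ hr.1 hq.1
    simp only [inner_sub_left, inner_sub_right, Set.mem_ofPred_eq, hr.2, hq.2] at h ⊢
    linarith [real_inner_comm r.1 r.2.1, real_inner_comm q.1 q.2.1, real_inner_comm r.1 q.2.1,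
      real_inner_comm q.1 r.2.1]
  have h2 := convexHull_min (fun q hq => by
    have := h1 q hq p hp
    simp only [Set.mem_ofPred_eq]
    linarith) (hconv p) hp
  simp only [Set.mem_ofPred_eq] at h2
  linarith

/-! ### Bijectivity of `∇f + B` -/

/-- Surjectivity of `∇f + B` for `f` fully Legendre and `B` maximally monotone. -/
theorem FullyLegendre.exists_sub_gradient_mem [FiniteDimensional ℝ E] {f : E → ℝ}
    (hf : FullyLegendre f) {B : E → Set E} (hB : IsMaximallyMonotone B) (w : E) :
    ∃ x, w - gateauxGradient f x ∈ B x := by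
  obtain ⟨fs, hfs, -⟩ := hf.exists_isLUB_conjugate
  have hFY : ∀ y x, inner ℝ y x - f x ≤ fs y := fun y x => (hfs y).1 ⟨x, rfl⟩
  have hfc : Continuous f := continuousOn_univ.1 (hf.convexOn.continuousOn isOpen_univ)
  have hfsconv := convexOn_of_isLUB_conjugate hfs
  have hfsc : Continuous fs := continuousOn_univ.1 (hfsconv.continuousOn isOpen_univ)
  obtain ⟨L, c, hLD, hLS⟩ := geometric_hahn_banach_open
    (s := {p : E × E × ℝ | p.2.2 < inner ℝ w p.1 - f p.1 - fs (w - p.2.1)})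
    (t := convexHull ℝ {p : E × E × ℝ | p.2.1 ∈ B p.1 ∧ p.2.2 = inner ℝ p.1 p.2.1})
    (by
      intro p hp q hq a b ha hb hab
      have h1 := hf.convexOn.2 (Set.mem_univ p.1) (Set.mem_univ q.1) ha hb hab
      have h2 := hfsconv.2 (Set.mem_univ (w - p.2.1)) (Set.mem_univ (w - q.2.1)) ha hb hab
      have h3 : a • (w - p.2.1) + b • (w - q.2.1) = w - (a • p.2.1 + b • q.2.1) := by
        obtain rfl : b = 1 - a := by linarith
        module
      rw [h3] at h2
      simp only [Set.mem_ofPred_eq, Prod.fst_add, Prod.snd_add, Prod.smul_fst, Prod.smul_snd,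
        inner_add_right, real_inner_smul_right, smul_eq_mul] at hp hq h1 h2 ⊢
      have h4 : a * p.2.2 + b * q.2.2 < a * (inner ℝ w p.1 - f p.1 - fs (w - p.2.1)) +
          b * (inner ℝ w q.1 - f q.1 - fs (w - q.2.1)) := by
        rcases ha.eq_or_lt with rfl | ha
        · obtain rfl : b = 1 := by linarith
          linarith
        · exact add_lt_add_of_lt_of_le (mul_lt_mul_of_pos_left hp ha)
            (mul_le_mul_of_nonneg_left hq.le hb)
      linarith)
    (isOpen_lt (by fun_prop) (by fun_prop))
    (convex_convexHull ℝ _)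
    (Set.disjoint_left.2 fun p hp hp' => by
      have h1 := inner_le_of_mem_convexHull_graph hB.1 hp'
      have h2 := hFY (w - p.2.1) p.1
      simp only [Set.mem_ofPred_eq, inner_sub_left] at hp h2
      linarith [real_inner_comm p.1 p.2.1])
  have hLS' : ∀ y v, v ∈ B y → c ≤ L (y, v, inner ℝ y v) := fun y v hv =>
    hLS _ (subset_convexHull ℝ _ ⟨hv, rfl⟩)
  obtain ⟨s, hs⟩ : ∃ s, s = L (0, 0, 1) := ⟨_, rfl⟩
  obtain ⟨p, hp⟩ : ∃ p : E, ∀ y, inner ℝ p y = L (y, 0, 0) :=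
    ⟨(InnerProductSpace.toDual ℝ E).symm (L ∘L ContinuousLinearMap.inl ℝ E (E × ℝ)),
      fun y => by simp [← Prod.mk_zero_zero]⟩
  obtain ⟨q, hq⟩ : ∃ q : E, ∀ v, inner ℝ q v = L (0, v, 0) :=
    ⟨(InnerProductSpace.toDual ℝ E).symm
      (L ∘L ContinuousLinearMap.inr ℝ E (E × ℝ) ∘L ContinuousLinearMap.inl ℝ E ℝ),
      fun v => by simp⟩
  have hL : ∀ y v t, L (y, v, t) = inner ℝ p y + inner ℝ q v + t * s := fun y v t => by
    rw [hp, hq, hs, ← smul_eq_mul, ← map_smul, ← map_add, ← map_add]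
    simp
  -- The separating hyperplane is not vertical: compare two points on the vertical line through a
  -- point of the graph of `B`.
  have hs0 : 0 < s := by
    obtain ⟨y, v, hv⟩ := hB.exists_mem
    obtain ⟨t, ht⟩ := exists_lt (min (inner ℝ y v) (inner ℝ w y - f y - fs (w - v)))
    have h1 := hLD (y, v, t) (ht.trans_le (min_le_right _ _))
    have h2 := hLS' y v hv
    have h3 := ht.trans_le (min_le_left _ _)
    rw [hL] at h1 h2
    by_contra! hs
    nlinarith [mul_nonneg (sub_nonneg.2 h3.le) (neg_nonneg.2 hs)]
  have hD : ∀ y v,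
      inner ℝ p y + inner ℝ q v + (inner ℝ w y - f y - fs (w - v)) * s ≤ c := fun y v => by
    refine le_of_forall_pos_lt_add fun ε hε => ?_
    have h1 := hLD (y, v, inner ℝ w y - f y - fs (w - v) - ε / s) (by
      simp only [Set.mem_ofPred_eq]
      linarith [div_pos hε hs0])
    rw [hL, sub_mul, div_mul_cancel₀ _ hs0.ne'] at h1
    linarith
  obtain ⟨x, hx⟩ : ∃ x : E, x = -(s⁻¹ • q) := ⟨_, rfl⟩
  obtain ⟨u, hu⟩ : ∃ u : E, u = -(s⁻¹ • p) := ⟨_, rfl⟩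
  have hqx : ∀ v, inner ℝ q v = -(inner ℝ x v * s) := fun v => by
    rw [hx, inner_neg_left, real_inner_smul_left]
    field_simp
  have hpu : ∀ v, inner ℝ p v = -(inner ℝ u v * s) := fun v => by
    rw [hu, inner_neg_left, real_inner_smul_left]
    field_simp
  have hS' : ∀ y v, v ∈ B y → c / s ≤ inner ℝ y v - inner ℝ u y - inner ℝ x v :=
    fun y v hv => by
      have h := hLS' y v hv
      rw [hL, hqx, hpu] at h
      rw [div_le_iff₀ hs0]
      linarith
  -- Equality in Fenchel-Young at `x`, with `v = w - ∇f x` in the bound on the open set, turns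
  -- `f*` back into `f`.
  have hsub : ∀ y, inner ℝ (w - u) y - f y + f x - inner ℝ x w ≤ c / s := fun y => by
    have h1 := hD y (w - gateauxGradient f x)
    have h2 : fs (gateauxGradient f x) ≤ inner ℝ (gateauxGradient f x) x - f x :=
      (hfs _).2 <| by
        rintro _ ⟨z, rfl⟩
        have := hf.add_inner_gradient_le x z
        simp only [inner_sub_right] at this ⊢
        linarith
    have h3 := mul_le_mul_of_nonneg_right h2 hs0.le
    rw [hqx, hpu, sub_sub_cancel, inner_sub_right] at h1
    rw [le_div_iff₀ hs0, inner_sub_left]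
    rw [real_inner_comm (gateauxGradient f x) x] at h1
    linarith
  have huB : u ∈ B x := hB.mem_of_forall fun y v hv => by
    have h1 := hS' y v hv
    have h2 := hsub x
    simp only [inner_sub_left, inner_sub_right] at h2 ⊢
    linarith [real_inner_comm x v, real_inner_comm y v, real_inner_comm x w]
  have hgrad : w - u = gateauxGradient f x :=
    (hf.gateauxDifferentiableAt x).hasGateauxGradientAt.eq_of_subgradient fun y => by
      have h1 := hS' x u huB
      have h2 := hsub y
      simp only [inner_sub_left, inner_sub_right] at h2 ⊢
      linarith [real_inner_comm x u, real_inner_comm x w]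
  exact ⟨x, by rwa [← hgrad, sub_sub_cancel]⟩

theorem FullyLegendre.existsUnique_sub_gradient_mem [FiniteDimensional ℝ E] {f : E → ℝ}
    (hf : FullyLegendre f) {B : E → Set E} (hB : IsMaximallyMonotone B) (w : E) :
    ∃! x, w - gateauxGradient f x ∈ B x := by
  refine existsUnique_of_exists_of_unique (hf.exists_sub_gradient_mem hB w) fun x y hx hy =>
    hf.eq_of_inner_gradient_sub_nonpos ?_
  have h := hB.1 _ _ _ _ hx hy
  rw [sub_sub_sub_cancel_left, ← neg_sub (gateauxGradient f x), inner_neg_left] at h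
  linarith

end BregmanProx

/-- A recursive inclusion with a uniquely solvable step determines exactly one sequence with a given
initial value. -/
theorem existsUnique_seq_of_existsUnique_step {α : Type*} {R : ℕ → α → α → Prop}
    (h : ∀ n a, ∃! b, R n a b) (a : α) :
    ∃! x : ℕ → α, x 0 = a ∧ ∀ n, R n (x n) (x (n + 1)) := by
  choose g hg hg' using h
  refine ⟨fun n => Nat.rec a g n, ⟨rfl, fun n => hg _ _⟩, ?_⟩
  rintro x ⟨rfl, hx⟩
  funext n
  induction n with
  | zero => rfl
  | succ n ih => rw [hg' n _ _ (hx n), ih]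

theorem theorem7p1 (m : ℕ)
    (f : EuclideanSpace ℝ (Fin m) → ℝ) (hf : BregmanProx.FullyLegendre f)
    (A : EuclideanSpace ℝ (Fin m) → Set (EuclideanSpace ℝ (Fin m)))
    (hA : BregmanProx.IsMaximallyMonotone A)
    (x₀ : EuclideanSpace ℝ (Fin m))
    (lam : ℕ → ℝ) (hlam : ∀ n : ℕ, 0 < lam n)
    (η : ℕ → EuclideanSpace ℝ (Fin m)) :
    (∃! x : ℕ → EuclideanSpace ℝ (Fin m), x 0 = x₀ ∧
      ∀ n : ℕ, η (n + 1) + BregmanProx.gateauxGradient f (x n) ∈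
        lam n • A (x (n + 1)) + {BregmanProx.gateauxGradient f (x (n + 1))}) ∧
    ∀ x : ℕ → EuclideanSpace ℝ (Fin m), x 0 = x₀ →
      (∀ n : ℕ, η (n + 1) + BregmanProx.gateauxGradient f (x n) ∈
        lam n • A (x (n + 1)) + {BregmanProx.gateauxGradient f (x (n + 1))}) →
      ∀ n : ℕ, BregmanProx.operatorInverse (BregmanProx.gradientAddSMul f (lam n) A)
        (η (n + 1) + BregmanProx.gateauxGradient f (x n)) = {x (n + 1)} := by
  have hmem : ∀ (c : ℝ) (w y : EuclideanSpace ℝ (Fin m)),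
      w ∈ c • A y + {BregmanProx.gateauxGradient f y} ↔
        w - BregmanProx.gateauxGradient f y ∈ (c • A) y := fun c w y => by
    rw [Set.add_singleton, Set.image_add_right, Set.mem_preimage, ← sub_eq_add_neg, Pi.smul_apply]
  have hstep := fun (n : ℕ) (w : EuclideanSpace ℝ (Fin m)) =>
    hf.existsUnique_sub_gradient_mem (hA.smul (hlam n)) w
  simp only [hmem]
  refine ⟨existsUnique_seq_of_existsUnique_step
    (fun n a => hstep n (η (n + 1) + BregmanProx.gateauxGradient f a)) x₀,
    fun x _ hx n => Set.eq_singleton_iff_unique_mem.2 ?_⟩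
  simp only [BregmanProx.operatorInverse, BregmanProx.gradientAddSMul, Set.mem_ofPred_eq,
    add_comm {_}, hmem]
  exact ⟨hx n, fun y hy => (hstep n _).unique hy (hx n)⟩
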